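/- Let $n$ be a natural number and let $f\in\mathbb{R}[x_1,\ldots,x_n]$ be a nonzero homogeneous polynomial. For $N\in\mathbb{N}$ put $\psi_N(x):=(x_1^2+\cdots+x_n^2)^N f(x)$. Then the following conditions are equivalent: (a) $f(x)>0$ for every $x\in\mathbb{R}^n\setminus\{0\}$; (b) there exists $N_1\in\mathbb{N}$ such that for every integer $N\ge N_1$ the polynomial $\psi_N$ is a sum of even powers of linear forms, that is, $\psi_N=\sum_{j=1}^{r}\ell_j^{2k_j}$ for some $r\ge 0$, integers $k_j\ge 1$ and real linear forms $\ell_j(x)=a_{j1}x_1+\cdots+a_{jn}x_n$; (c) there exists $N_2\in\mathbb{N}$ such that for every integer $N\ge N_2$ the polynomial $\psi_N$ is a convex function on $\mathbb{R}^n$; (d) there exists $N_3\in\mathbb{N}$ such that for every integer $N\ge N_3$ the polynomial $\psi_N$ is a strictly convex function on $\mathbb{R}^n$. -/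

import Mathlib

/-- The polynomial `(x₁² + ⋯ + xₙ²)^N * f`. -/
noncomputable def psi {n : ℕ} (f : MvPolynomial (Fin n) ℝ) (N : ℕ) : MvPolynomial (Fin n) ℝ :=
  (∑ i : Fin n, MvPolynomial.X i ^ 2) ^ N * f

/-- `p` is a finite sum of even powers (with positive exponents, which may differ from term to
term) of linear forms, as an identity of polynomials. -/
def IsSumOfEvenPowers {n : ℕ} (p : MvPolynomial (Fin n) ℝ) : Prop :=
  ∃ (r : ℕ) (l : Fin r → MvPolynomial (Fin n) ℝ) (k : Fin r → ℕ),
    (∀ j, (l j).IsHomogeneous 1) ∧ (∀ j, 1 ≤ k j) ∧ p = ∑ j : Fin r, l j ^ (2 * k j)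

/-! Positivity gives sums of even powers by Reznick's argument. Hilbert's identity writes
|x|^(2(N+d)) as a nonnegative combination of powers ℓ_k^(2(N+d)), where ℓ_k has coefficient vector
a_k. Apply h(∂) for a form h of degree d. The right side becomes a combination of ℓ_k^(2N+d) whose
weights are nonnegative multiples of h(a_k) (`diffOp_linearForm_pow`). The left side becomes a
positive constant times |x|^(2N) A_N h (`diffOp_sqNorm_pow`), where A_N is `reznickOp`. As A_N → 1,
for large N the equation A_N h = f has a solution so near f that it is still positive
(`exists_pos_reznickOp_eq`).

Such sums are convex, and strictly so when they vanish only at 0. Conversely, convex forms of degree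
at least 2 are nonnegative and constant along the direction of any zero v. If f(v) = 0, comparing
ψ_N with ψ_(N+1) makes |x|² constant along v wherever ψ_N ≠ 0, which is impossible, so f = 0. -/

section

open MvPolynomial

/-! ### Constant coefficient differential operators acting on powers. -/

namespace MvPolynomial

variable {n : ℕ}

lemma pderiv_comm {σ R : Type*} [CommSemiring R] (i j : σ) (p : MvPolynomial σ R) :
    pderiv i (pderiv j p) = pderiv j (pderiv i p) := by
  classical
  ext m
  simp only [coeff_pderiv, Finsupp.add_apply]
  rw [add_right_comm]
  rcases eq_or_ne i j with rfl | h
  · rfl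
  · simp [h, h.symm]; ring

/-- Induction principle for homogeneous polynomials. -/
theorem IsHomogeneous.induction {σ R : Type*} [CommSemiring R]
    {motive : ℕ → MvPolynomial σ R → Prop}
    (zero : ∀ d, motive d 0) (C : ∀ a, motive 0 (C a))
    (add : ∀ d p q, motive d p → motive d q → motive d (p + q))
    (mul_X : ∀ d p i, p.IsHomogeneous d → motive d p → motive (d + 1) (p * X i))
    {d : ℕ} {p : MvPolynomial σ R} (hp : p.IsHomogeneous d) : motive d p := by
  have key : ∀ (s : σ →₀ ℕ) (a : R), ∃ e, (monomial s a).IsHomogeneous e ∧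
      motive e (monomial s a) := by
    refine induction_on_monomial (fun a => ⟨0, isHomogeneous_C _ _, C a⟩) ?_
    rintro q i ⟨e, he, hq⟩
    exact ⟨e + 1, he.mul (isHomogeneous_X _ _), mul_X e q i he hq⟩
  rw [p.as_sum]
  refine Finset.sum_induction _ (motive d) (add d) (zero d) ?_
  intro s hs
  obtain ⟨e, he, hm⟩ := key s (coeff s p)
  have h0 : monomial s (coeff s p) ≠ 0 := by
    simpa using mem_support_iff.mp hs
  have hd : (monomial s (coeff s p)).IsHomogeneous d := by
    refine isHomogeneous_monomial _ ?_
    by_contra hne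
    exact mem_support_iff.mp hs (hp.coeff_eq_zero hne)
  rwa [hd.inj_right he h0]

/-- The algebra of constant coefficient differential operators. -/
noncomputable abbrev diffOps (n : ℕ) :
    Subalgebra ℝ (Module.End ℝ (MvPolynomial (Fin n) ℝ)) :=
  Algebra.adjoin ℝ (Set.range fun i : Fin n => (pderiv (R := ℝ) i).toLinearMap)

/-- Evaluating a polynomial at the ∂ᵢ through `aeval` needs a commutative target, hence the detour
through this subalgebra. -/
instance : IsMulCommutative (diffOps n) :=
  Algebra.isMulCommutative_adjoin ℝ (by
    rintro _ ⟨i, rfl⟩ _ ⟨j, rfl⟩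
    exact LinearMap.ext fun p => pderiv_comm i j p)

open scoped IsMulCommutative in
/-- The differential operator `p(∂)` attached to a polynomial `p`. -/
noncomputable def diffOp : MvPolynomial (Fin n) ℝ →ₐ[ℝ]
    Module.End ℝ (MvPolynomial (Fin n) ℝ) :=
  (diffOps n).val.comp (aeval fun i =>
    (⟨(pderiv (R := ℝ) i).toLinearMap, Algebra.subset_adjoin ⟨i, rfl⟩⟩ : diffOps n))

open scoped IsMulCommutative in
lemma diffOp_X (i : Fin n) (q : MvPolynomial (Fin n) ℝ) : diffOp (X i) q = pderiv i q := by
  simp [diffOp]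

lemma diffOp_mul_X (p q : MvPolynomial (Fin n) ℝ) (i : Fin n) :
    diffOp (p * X i) q = pderiv i (diffOp p q) := by
  rw [mul_comm, map_mul, Module.End.mul_apply, diffOp_X]

lemma diffOp_C (a : ℝ) (q : MvPolynomial (Fin n) ℝ) : diffOp (C a) q = C a * q := by
  rw [← algebraMap_eq, AlgHom.commutes, Module.algebraMap_end_apply, algebraMap_eq, C_mul']

/-- The linear form `∑ aᵢ xᵢ`. -/
noncomputable def linearForm (a : Fin n → ℝ) : MvPolynomial (Fin n) ℝ := ∑ i, C (a i) * X i

lemma isHomogeneous_linearForm (a : Fin n → ℝ) : (linearForm a).IsHomogeneous 1 :=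
  IsHomogeneous.sum _ _ _ fun _ _ => isHomogeneous_C_mul_X _ _

lemma eval_linearForm (a x : Fin n → ℝ) : eval x (linearForm a) = ∑ i, a i * x i := by
  simp [linearForm]

lemma pderiv_linearForm (a : Fin n → ℝ) (i : Fin n) : pderiv i (linearForm a) = C (a i) := by
  simp [linearForm, Pi.single_apply]

/-- Each ∂ᵢ brings down the current exponent and a factor aᵢ. For d > m the falling factorial is 0,
so the truncated exponent is harmless. -/
lemma diffOp_linearForm_pow (a : Fin n → ℝ) (m : ℕ) {d : ℕ} {p : MvPolynomial (Fin n) ℝ}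
    (hp : p.IsHomogeneous d) :
    diffOp p (linearForm a ^ m) = C (m.descFactorial d * eval a p) * linearForm a ^ (m - d) := by
  refine IsHomogeneous.induction (motive := fun d p => diffOp p (linearForm a ^ m) =
    C (m.descFactorial d * eval a p) * linearForm a ^ (m - d)) ?_ ?_ ?_ ?_ hp
  · simp
  · intro b
    rw [diffOp_C]
    simp
  · intro d p q h1 h2
    simp [h1, h2]; ring
  · intro d p i _ h
    rw [diffOp_mul_X, h, pderiv_C_mul, pderiv_pow, pderiv_linearForm, Nat.descFactorial_succ,
      Nat.sub_sub]
    simp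
    ring

/-- The squared Euclidean norm as a polynomial. -/
noncomputable def sqNorm (n : ℕ) : MvPolynomial (Fin n) ℝ := ∑ i, X i ^ 2

lemma isHomogeneous_sqNorm : (sqNorm n).IsHomogeneous 2 :=
  IsHomogeneous.sum _ _ _ fun _ _ => isHomogeneous_X_pow _ _

lemma eval_sqNorm (x : Fin n → ℝ) : eval x (sqNorm n) = ∑ i, x i ^ 2 := by
  simp [sqNorm]

lemma pderiv_sqNorm (i : Fin n) : pderiv i (sqNorm n) = 2 * X i := by
  classical
  simp [sqNorm, Pi.single_apply]

/-- The Laplace operator. -/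
noncomputable def laplacian : Module.End ℝ (MvPolynomial (Fin n) ℝ) :=
  ∑ i : Fin n, (pderiv (R := ℝ) i).toLinearMap * (pderiv (R := ℝ) i).toLinearMap

lemma laplacian_apply (p : MvPolynomial (Fin n) ℝ) :
    laplacian p = ∑ i, pderiv i (pderiv i p) := by
  simp [laplacian]

lemma laplacian_mul_X (p : MvPolynomial (Fin n) ℝ) (i : Fin n) :
    laplacian (p * X i) = laplacian p * X i + 2 * pderiv i p := by
  classical
  simp only [laplacian_apply, pderiv_mul, map_add, pderiv_X, Finset.sum_add_distrib,
    Finset.sum_mul]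
  have h : ∀ k : Fin n, pderiv k (if i = k then (1 : MvPolynomial (Fin n) ℝ) else 0) = 0 := by
    intro k
    split_ifs <;> simp
  simp [h, Pi.single_apply]
  ring

lemma pderiv_laplacian (p : MvPolynomial (Fin n) ℝ) (i : Fin n) :
    pderiv i (laplacian p) = laplacian (pderiv i p) := by
  simp only [laplacian_apply, map_sum]
  exact Finset.sum_congr rfl fun k _ => by rw [pderiv_comm i k, pderiv_comm i k]

lemma laplacian_pow_succ_mul_X (j : ℕ) (p : MvPolynomial (Fin n) ℝ) (i : Fin n) :
    (laplacian ^ (j + 1)) (p * X i) =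
      (laplacian ^ (j + 1)) p * X i + C (2 * (j + 1) : ℝ) * pderiv i ((laplacian ^ j) p) := by
  induction j with
  | zero => simpa [map_ofNat] using laplacian_mul_X p i
  | succ j ih =>
    rw [pow_succ', Module.End.mul_apply, ih, map_add, laplacian_mul_X, C_mul', map_smul,
      ← pderiv_laplacian, ← Module.End.mul_apply, ← Module.End.mul_apply, ← pow_succ',
      ← pow_succ', ← C_mul',
      show (2 * ((j + 1 : ℕ) + 1) : ℝ) = 2 * (j + 1) + 2 by push_cast; ring, C_add,
      show (C (2 : ℝ) : MvPolynomial (Fin n) ℝ) = 2 from map_ofNat _ 2]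
    ring

lemma isHomogeneous_laplacian {d : ℕ} {p : MvPolynomial (Fin n) ℝ} (hp : p.IsHomogeneous d) :
    (laplacian p).IsHomogeneous (d - 2) := by
  rw [laplacian_apply]
  exact IsHomogeneous.sum _ _ _ fun i _ => hp.pderiv.pderiv

lemma laplacian_eq_zero {d : ℕ} {p : MvPolynomial (Fin n) ℝ} (hp : p.IsHomogeneous d)
    (hd : d < 2) : laplacian p = 0 := by
  rw [laplacian_apply]
  refine Finset.sum_eq_zero fun i _ => ?_
  have h : (pderiv i p).IsHomogeneous 0 := by
    simpa [Nat.sub_eq_zero_of_le (Nat.le_of_lt_succ hd)] using hp.pderiv (i := i)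
  rw [totalDegree_eq_zero_iff_eq_C.mp (Nat.le_zero.mp h.totalDegree_le), pderiv_C]

/-- The vanishing clause covers the range where d - 2 * j truncates; with it, |x|²ʲ Δʲ preserves
degree d for every j. -/
lemma isHomogeneous_laplacian_pow {d : ℕ} {p : MvPolynomial (Fin n) ℝ} (hp : p.IsHomogeneous d)
    (j : ℕ) : ((laplacian ^ j) p).IsHomogeneous (d - 2 * j) ∧
      (d < 2 * j → (laplacian ^ j) p = 0) := by
  induction j with
  | zero => simpa using hp
  | succ j ih =>
    rw [pow_succ', Module.End.mul_apply]
    refine ⟨by simpa [Nat.sub_sub, mul_add] using isHomogeneous_laplacian ih.1, fun h => ?_⟩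
    by_cases hj : d < 2 * j
    · rw [ih.2 hj, map_zero]
    · exact laplacian_eq_zero ih.1 (by omega)

lemma isHomogeneous_sqNorm_pow_mul_laplacian_pow {d : ℕ} {p : MvPolynomial (Fin n) ℝ}
    (hp : p.IsHomogeneous d) (j : ℕ) :
    (sqNorm n ^ j * (laplacian ^ j) p).IsHomogeneous d := by
  obtain ⟨h1, h2⟩ := isHomogeneous_laplacian_pow hp j
  by_cases h : d < 2 * j
  · rw [h2 h, mul_zero]; exact isHomogeneous_zero _ _ _
  · convert (isHomogeneous_sqNorm.pow j).mul h1 using 1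
    omega

open Nat in
-- Induction on multiplication by xᵢ: the ∂ᵢ Δʲ p terms of the product rule match those of the
-- commutator [Δʲ⁺¹, xᵢ] = 2(j+1) ∂ᵢ Δʲ.
lemma diffOp_sqNorm_pow (N : ℕ) {d : ℕ} {p : MvPolynomial (Fin n) ℝ} (hp : p.IsHomogeneous d) :
    diffOp p (sqNorm n ^ (N + d)) = ∑ j ∈ Finset.range (d + 1),
      C ((N + d)! * 2 ^ d / (4 ^ j * j ! * (N + j)!) : ℝ) *
        (sqNorm n ^ (N + j) * (laplacian ^ j) p) := by
  refine IsHomogeneous.induction (motive := fun d p => ∀ N, diffOp p (sqNorm n ^ (N + d)) =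
    ∑ j ∈ Finset.range (d + 1), C ((N + d)! * 2 ^ d / (4 ^ j * j ! * (N + j)!) : ℝ) *
        (sqNorm n ^ (N + j) * (laplacian ^ j) p)) ?_ ?_ ?_ ?_ hp N
  · simp
  · intro a N
    have : (N ! : ℝ) ≠ 0 := by positivity
    rw [diffOp_C]
    simp [this, mul_comm]
  · intro d p q h1 h2 N
    simp [h1, h2, mul_add, Finset.sum_add_distrib]
  · intro d p i hp h N
    have hz : (laplacian ^ (d + 1)) p = 0 := (isHomogeneous_laplacian_pow hp (d + 1)).2 (by omega)
    rw [diffOp_mul_X, show N + (d + 1) = N + 1 + d by ring, h (N + 1), map_sum,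
      Finset.sum_range_succ' _ (d + 1)]
    have e1 : ∀ j ∈ Finset.range (d + 1),
        C ((N + 1 + d)! * 2 ^ (d + 1) / (4 ^ (j + 1) * (j + 1)! * (N + (j + 1))!) : ℝ) *
          (sqNorm n ^ (N + (j + 1)) * (laplacian ^ (j + 1)) (p * X i)) =
        C ((N + 1 + d)! * 2 ^ (d + 1) / (4 ^ (j + 1) * (j + 1)! * (N + (j + 1))!) : ℝ) *
          (sqNorm n ^ (N + (j + 1)) * ((laplacian ^ (j + 1)) p * X i)) +
        C ((N + 1 + d)! * 2 ^ d / (4 ^ j * j ! * (N + 1 + j)!) : ℝ) *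
          (sqNorm n ^ (N + 1 + j) * pderiv i ((laplacian ^ j) p)) := by
      intro j _
      have e : ((N + 1 + d)! * 2 ^ d / (4 ^ j * j ! * (N + 1 + j)!) : ℝ) =
          ((N + 1 + d)! * 2 ^ (d + 1) / (4 ^ (j + 1) * (j + 1)! * (N + (j + 1))!)) *
            (2 * (j + 1)) := by
        rw [show N + 1 + j = N + (j + 1) by ring, Nat.factorial_succ j]
        push_cast
        field_simp
        ring
      rw [laplacian_pow_succ_mul_X, e, C_mul (a' := 2 * ((j : ℝ) + 1)), show N + 1 + j = N + (j + 1) by ring]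
      ring
    have e2 : ∀ j ∈ Finset.range (d + 1),
        pderiv i (C ((N + 1 + d)! * 2 ^ d / (4 ^ j * j ! * (N + 1 + j)!) : ℝ) *
          (sqNorm n ^ (N + 1 + j) * (laplacian ^ j) p)) =
        C ((N + 1 + d)! * 2 ^ (d + 1) / (4 ^ j * j ! * (N + j)!) : ℝ) *
          (sqNorm n ^ (N + j) * ((laplacian ^ j) p * X i)) +
        C ((N + 1 + d)! * 2 ^ d / (4 ^ j * j ! * (N + 1 + j)!) : ℝ) *
          (sqNorm n ^ (N + 1 + j) * pderiv i ((laplacian ^ j) p)) := by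
      intro j _
      have e : ((N + 1 + d)! * 2 ^ (d + 1) / (4 ^ j * j ! * (N + j)!) : ℝ) =
          ((N + 1 + d)! * 2 ^ d / (4 ^ j * j ! * (N + 1 + j)!)) * ((N + 1 + j : ℕ) * 2) := by
        rw [show N + 1 + j = N + j + 1 by ring, Nat.factorial_succ (N + j)]
        push_cast
        field_simp
        ring
      rw [pderiv_C_mul, pderiv_mul, pderiv_pow, pderiv_sqNorm, e, C_mul, C_mul, map_natCast,
        show N + 1 + j - 1 = N + j by omega, map_ofNat]
      ring
    rw [Finset.sum_congr rfl e1, Finset.sum_congr rfl e2, Finset.sum_add_distrib,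
      Finset.sum_add_distrib, Finset.sum_range_succ' _ d]
    simp only [Finset.sum_range_succ _ d, hz]
    simp
    ring

end MvPolynomial

/-! ### Carathéodory's theorem and compactness of convex hulls. -/

section ConvexHull

open Module in
/-- In a finite-dimensional space, every point of a convex hull is a convex combination of
`finrank + 1` points. -/
lemma exists_fin_of_mem_convexHull {E : Type*} [AddCommGroup E] [Module ℝ E]
    [FiniteDimensional ℝ E] {s : Set E} {x : E} (hx : x ∈ convexHull ℝ s) :
    ∃ w ∈ stdSimplex ℝ (Fin (finrank ℝ E + 1)), ∃ z : Fin (finrank ℝ E + 1) → E,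
      (∀ i, z i ∈ s) ∧ ∑ i, w i • z i = x := by
  classical
  obtain ⟨y, hy⟩ : s.Nonempty := convexHull_nonempty_iff.mp ⟨x, hx⟩
  obtain ⟨ι, _, z, w, hz, hind, hw, hw1, rfl⟩ := eq_pos_convex_span_of_mem_convexHull hx
  have hcard : Fintype.card ι ≤ Fintype.card (Fin (finrank ℝ E + 1)) := by
    rw [Fintype.card_fin]
    exact hind.card_le_finrank_succ.trans (Nat.succ_le_succ (Submodule.finrank_le _))
  obtain ⟨e⟩ := Function.Embedding.nonempty_of_card_le hcard
  have hout : ∀ i, i ∉ Set.range e → Function.extend e w 0 i = 0 := fun i hi =>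
    Function.extend_apply' _ _ _ hi
  refine ⟨Function.extend e w 0, ⟨fun i => ?_, ?_⟩, Function.extend e z fun _ => y, fun i => ?_, ?_⟩
  · by_cases hi : i ∈ Set.range e
    · obtain ⟨j, rfl⟩ := hi
      simpa [e.injective.extend_apply] using (hw j).le
    · rw [hout i hi]
  · rw [← hw1]
    exact (Fintype.sum_of_injective e e.injective _ _ hout fun j => by
      rw [e.injective.extend_apply]).symm
  · by_cases hi : i ∈ Set.range e
    · obtain ⟨j, rfl⟩ := hi
      simpa [e.injective.extend_apply] using hz ⟨j, rfl⟩
    · rwa [Function.extend_apply' _ _ _ hi]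
  · exact (Fintype.sum_of_injective e e.injective _ _
      (fun i hi => by rw [hout i hi, zero_smul]) fun j => by
        rw [e.injective.extend_apply, e.injective.extend_apply]).symm

/-- The convex hull of a compact set in a finite-dimensional space is compact. -/
lemma IsCompact.convexHull_of_finiteDimensional {E : Type*} [NormedAddCommGroup E]
    [NormedSpace ℝ E] [FiniteDimensional ℝ E] {s : Set E} (hs : IsCompact s) :
    IsCompact (convexHull ℝ s) := by
  let N := Module.finrank ℝ E + 1
  have hK : IsCompact (stdSimplex ℝ (Fin N) ×ˢ Set.univ.pi fun _ : Fin N => s) :=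
    (isCompact_stdSimplex ℝ (Fin N)).prod (isCompact_univ_pi fun _ => hs)
  convert hK.image (f := fun p : (Fin N → ℝ) × (Fin N → E) => ∑ i, p.1 i • p.2 i) (by fun_prop)
    using 1
  ext x
  constructor
  · intro hx
    obtain ⟨w, hw, z, hz, rfl⟩ := exists_fin_of_mem_convexHull hx
    exact ⟨(w, z), ⟨hw, fun i _ => hz i⟩, rfl⟩
  · rintro ⟨⟨w, z⟩, ⟨hw, hz⟩, rfl⟩
    exact mem_convexHull_of_exists_fintype w z hw.1 hw.2 (fun i => hz i trivial) rfl

end ConvexHull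

/-! ### Hilbert's identity by rotation-invariant averaging and cubature. -/

section Hilbert

open MeasureTheory Metric

variable {n : ℕ}

/-- The reflection in the hyperplane orthogonal to x - y sends x to y and preserves the ball and its
volume. -/
lemma setIntegral_ball_inner_pow_congr (m : ℕ) {x y : EuclideanSpace ℝ (Fin n)} (h : ‖x‖ = ‖y‖) :
    ∫ u in closedBall (0 : EuclideanSpace ℝ (Fin n)) 1, inner ℝ x u ^ m =
      ∫ u in closedBall (0 : EuclideanSpace ℝ (Fin n)) 1, inner ℝ y u ^ m := by
  set ρ := (ℝ ∙ (x - y))ᗮ.reflection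
  have hρ : ρ x = y := Submodule.reflection_sub h
  have key := ρ.measurePreserving.setIntegral_preimage_emb
    ρ.toHomeomorph.measurableEmbedding (fun u => inner ℝ y u ^ m) (closedBall 0 1)
  rw [← key]
  have hpre : ρ ⁻¹' closedBall 0 1 = closedBall 0 1 := by
    ext u; simp
  rw [hpre]
  simp_rw [← hρ, LinearIsometryEquiv.inner_map_map]

lemma setIntegral_ball_inner_pow_pos [NeZero n] (s : ℕ) :
    0 < ∫ u in closedBall (0 : EuclideanSpace ℝ (Fin n)) 1,
      inner ℝ (EuclideanSpace.single 0 1) u ^ (2 * s) := by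
  have hcont : Continuous fun u : EuclideanSpace ℝ (Fin n) =>
      inner ℝ (EuclideanSpace.single 0 (1 : ℝ)) u ^ (2 * s) := by fun_prop
  rw [setIntegral_pos_iff_support_of_nonneg_ae]
  · have hopen : IsOpen ((Function.support fun u : EuclideanSpace ℝ (Fin n) =>
      inner ℝ (EuclideanSpace.single 0 (1 : ℝ)) u ^ (2 * s)) ∩ ball 0 1) :=
      hcont.isOpen_support.inter isOpen_ball
    refine (hopen.measure_pos volume
      ⟨EuclideanSpace.single 0 (1 / 2), ?_, ?_⟩).trans_le (measure_mono ?_)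
    · simp [EuclideanSpace.inner_single_left]
    · simp; norm_num
    · exact Set.inter_subset_inter_right _ ball_subset_closedBall
  · exact Filter.Eventually.of_forall fun u => (even_two_mul s).pow_nonneg _
  · exact hcont.continuousOn.integrableOn_compact (isCompact_closedBall _ _)

lemma setIntegral_ball_inner_pow [NeZero n] (s : ℕ) (x : EuclideanSpace ℝ (Fin n)) :
    ∫ u in closedBall (0 : EuclideanSpace ℝ (Fin n)) 1, inner ℝ x u ^ (2 * s) =
      (‖x‖ ^ 2) ^ s * ∫ u in closedBall (0 : EuclideanSpace ℝ (Fin n)) 1,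
        inner ℝ (EuclideanSpace.single 0 1) u ^ (2 * s) := by
  rw [setIntegral_ball_inner_pow_congr (2 * s)
    (y := ‖x‖ • EuclideanSpace.single (0 : Fin n) (1 : ℝ)) (by simp [norm_smul])]
  simp_rw [inner_smul_left, mul_pow]
  rw [integral_const_mul]
  simp [pow_mul]

/-- Averages over a compact set of finitely many continuous functions are given by
cubature formulas with nonnegative weights. -/
lemma exists_cubature {E ι : Type*} [TopologicalSpace E] [MeasurableSpace E] [BorelSpace E]
    [T2Space E] [Fintype ι] {μ : Measure E} [IsFiniteMeasureOnCompacts μ] {K : Set E}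
    (hK : IsCompact K) (h0 : μ K ≠ 0) {F : E → ι → ℝ} (hF : Continuous F) :
    ∃ (κ : Type) (_ : Fintype κ) (w : κ → ℝ) (a : κ → E), (∀ k, 0 ≤ w k) ∧
      ∑ k, w k • F (a k) = ∫ u in K, F u ∂μ := by
  have hKt : μ K ≠ ⊤ := hK.measure_lt_top.ne
  have hmem : (⨍ u in K, F u ∂μ) ∈ convexHull ℝ (F '' K) := by
    refine (convex_convexHull ℝ _).set_average_mem
      (hK.image hF).convexHull_of_finiteDimensional.isClosed h0 hKt ?_
      (hF.continuousOn.integrableOn_compact hK)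
    filter_upwards [ae_restrict_mem hK.measurableSet] with u hu
    exact subset_convexHull ℝ _ ⟨u, hu, rfl⟩
  obtain ⟨κ, _, w, z, hw, -, hz, hx⟩ := mem_convexHull_iff_exists_fintype.mp hmem
  choose a _ ha using hz
  -- The convex combination represents the average; scaling by the measure of K gives the integral.
  refine ⟨κ, inferInstance, fun k => μ.real K * w k, a, fun k => by positivity [hw k], ?_⟩
  have hne : μ.real K ≠ 0 := by simp [Measure.real, ENNReal.toReal_eq_zero_iff, h0, hKt]
  rw [setAverage_eq] at hx
  simp_rw [ha, mul_smul, ← Finset.smul_sum, hx, smul_smul, mul_inv_cancel₀ hne, one_smul]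

/-- **Hilbert's identity**: powers of the squared norm are nonnegative combinations of even powers
of linear forms. -/
theorem exists_sqNorm_pow_eq_sum [NeZero n] (s : ℕ) :
    ∃ (κ : Type) (_ : Fintype κ) (w : κ → ℝ) (a : κ → Fin n → ℝ), (∀ k, 0 ≤ w k) ∧
      sqNorm n ^ s = ∑ k, C (w k) * linearForm (a k) ^ (2 * s) := by
  -- F lists all degree 2s monomials in u. Since ⟨x, u⟩^(2s) is linear in F u, a single cubature
  -- formula serves every x.
  let F : EuclideanSpace ℝ (Fin n) → (Fin (2 * s) → Fin n) → ℝ := fun u p => ∏ i, u (p i)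
  have hF : Continuous F := by fun_prop
  have hK := isCompact_closedBall (0 : EuclideanSpace ℝ (Fin n)) 1
  obtain ⟨κ, _, w, a, hw, h⟩ := exists_cubature (μ := volume) hK
    (measure_closedBall_pos volume _ one_pos).ne' hF
  set c := ∫ u in closedBall (0 : EuclideanSpace ℝ (Fin n)) 1,
    inner ℝ (EuclideanSpace.single 0 1) u ^ (2 * s) with hc
  have hcpos : 0 < c := setIntegral_ball_inner_pow_pos s
  have hpow : ∀ x u : EuclideanSpace ℝ (Fin n),
      inner ℝ x u ^ (2 * s) = ∑ p : Fin (2 * s) → Fin n, (∏ i, x (p i)) * F u p := by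
    intro x u
    rw [PiLp.inner_apply, Fintype.sum_pow]
    simp [F, Finset.prod_mul_distrib, mul_comm]
  have hsum : ∀ x : EuclideanSpace ℝ (Fin n),
      ∑ k, w k * inner ℝ x (a k) ^ (2 * s) = (‖x‖ ^ 2) ^ s * c := by
    intro x
    rw [hc, ← setIntegral_ball_inner_pow]
    simp_rw [hpow]
    rw [integral_finsetSum]
    · simp_rw [integral_const_mul]
      have hp : ∀ p, ∫ u in closedBall (0 : EuclideanSpace ℝ (Fin n)) 1, F u p =
          ∑ k, w k * F (a k) p := by
        intro p
        rw [← eval_integral]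
        · rw [← h]; simp
        · intro q
          have : Continuous fun u => F u q := by fun_prop
          exact this.continuousOn.integrableOn_compact hK
      simp_rw [hp, Finset.mul_sum]
      rw [Finset.sum_comm]
      exact Finset.sum_congr rfl fun p _ => Finset.sum_congr rfl fun k _ => by ring
    · intro p _
      have : Continuous fun u => (∏ i, x (p i)) * F u p := by fun_prop
      exact this.continuousOn.integrableOn_compact hK
  refine ⟨κ, inferInstance, fun k => w k / c, fun k => a k, fun k => div_nonneg (hw k) hcpos.le, ?_⟩
  refine MvPolynomial.funext fun x => ?_
  have hx := hsum (WithLp.toLp 2 x)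
  simp only [PiLp.inner_apply, EuclideanSpace.norm_sq_eq] at hx
  simp only [map_pow, map_sum, map_mul, eval_sqNorm, eval_linearForm, eval_C]
  rw [← mul_left_inj' hcpos.ne', Finset.sum_mul]
  simp only [Real.norm_eq_abs, sq_abs] at hx
  rw [← hx]
  refine Finset.sum_congr rfl fun k _ => ?_
  field_simp
  simp

end Hilbert

/-! ### Inverting a perturbation of the identity on forms. -/

section Perturbation

open Filter Topology

/-- Operators converging to the identity are eventually invertible, with inverses converging to
the identity. -/
lemma exists_tendsto_preimage {W : Type*} [NormedAddCommGroup W] [NormedSpace ℝ W]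
    [CompleteSpace W] {A : ℕ → W →L[ℝ] W} (hA : Tendsto A atTop (𝓝 1)) (v : W) :
    ∃ h : ℕ → W, Tendsto h atTop (𝓝 v) ∧ ∀ᶠ N in atTop, A N (h N) = v := by
  have hinv : Tendsto (fun N => Ring.inverse (A N)) atTop (𝓝 1) := by
    have := NormedRing.inverse_continuousAt (1 : (W →L[ℝ] W)ˣ)
    rw [ContinuousAt, Units.val_one, Ring.inverse_one] at this
    exact this.comp hA
  refine ⟨fun N => Ring.inverse (A N) v, ?_, ?_⟩
  · exact ((ContinuousLinearMap.apply ℝ W v).continuous.tendsto 1).comp hinv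
  · have hu : ∀ᶠ N in atTop, IsUnit (A N) :=
      hA (Units.isOpen.mem_nhds (isUnit_one : IsUnit (1 : W →L[ℝ] W)))
    filter_upwards [hu] with N hN
    rw [← mul_apply_eq_comp, Ring.mul_inverse_cancel _ hN,
      one_apply_eq_self]

variable {n : ℕ}

namespace MvPolynomial

lemma IsHomogeneous.eval_smul {d : ℕ} {p : MvPolynomial (Fin n) ℝ} (hp : p.IsHomogeneous d)
    (t : ℝ) (x : Fin n → ℝ) : eval (t • x) p = t ^ d * eval x p := by
  refine IsHomogeneous.induction
    (motive := fun d p => eval (t • x) p = t ^ d * eval x p) ?_ ?_ ?_ ?_ hp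
  · simp
  · simp
  · intro d p q h1 h2
    simp [h1, h2, mul_add]
  · intro d p i _ h
    simp [h, pow_succ]
    ring

/-- The operator `p ↦ |x|²ʲ Δʲ p` on forms of degree `d`. -/
noncomputable def sqNormLaplacian (n d j : ℕ) :
    Module.End ℝ (homogeneousSubmodule (Fin n) ℝ d) :=
  LinearMap.restrict (LinearMap.mulLeft ℝ (sqNorm n ^ j) * laplacian ^ j)
    fun p hp => isHomogeneous_sqNorm_pow_mul_laplacian_pow (p := p) hp j

lemma coe_sqNormLaplacian_apply {d : ℕ} (j : ℕ) (p : homogeneousSubmodule (Fin n) ℝ d) :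
    (sqNormLaplacian n d j p : MvPolynomial (Fin n) ℝ) = sqNorm n ^ j * (laplacian ^ j) ↑p :=
  rfl

lemma sqNormLaplacian_zero (n d : ℕ) : sqNormLaplacian n d 0 = 1 :=
  LinearMap.ext fun p => Subtype.ext <| by simp [coe_sqNormLaplacian_apply]

/-- The operator `p ↦ ∑ⱼ N! / (4ʲ j! (N + j)!) |x|²ʲ Δʲ p` on forms of degree `d`. -/
noncomputable def reznickOp (n d N : ℕ) :
    homogeneousSubmodule (Fin n) ℝ d →ₗ[ℝ] homogeneousSubmodule (Fin n) ℝ d :=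
  ∑ j ∈ Finset.range (d + 1), (N.factorial / (4 ^ j * j.factorial * (N + j).factorial) : ℝ) •
    sqNormLaplacian n d j

lemma diffOp_sqNorm_pow_eq_reznickOp {d : ℕ} (N : ℕ) (p : homogeneousSubmodule (Fin n) ℝ d) :
    diffOp (p : MvPolynomial (Fin n) ℝ) (sqNorm n ^ (N + d)) =
      C ((N + d).factorial * 2 ^ d / N.factorial : ℝ) *
        (sqNorm n ^ N * (reznickOp n d N p : MvPolynomial (Fin n) ℝ)) := by
  rw [diffOp_sqNorm_pow N p.2]
  simp only [reznickOp, LinearMap.sum_apply, Submodule.coe_sum, Finset.mul_sum]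
  refine Finset.sum_congr rfl fun j _ => ?_
  have h : (N.factorial : ℝ) ≠ 0 := by positivity
  rw [LinearMap.smul_apply, Submodule.coe_smul, ← C_mul', coe_sqNormLaplacian_apply,
    pow_add,
    show ((N + d).factorial * 2 ^ d / (4 ^ j * j.factorial * (N + j).factorial) : ℝ) =
      ((N + d).factorial * 2 ^ d / N.factorial) *
        (N.factorial / (4 ^ j * j.factorial * (N + j).factorial)) by field_simp, C_mul]
  ring

lemma tendsto_factorial_div (j : ℕ) : Tendsto (fun N : ℕ =>
    (N.factorial / (4 ^ (j + 1) * (j + 1).factorial * (N + (j + 1)).factorial) : ℝ)) atTop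
    (𝓝 0) := by
  refine squeeze_zero (fun N => by positivity) (fun N => ?_)
    (tendsto_one_div_add_atTop_nhds_zero_nat (𝕜 := ℝ))
  rw [div_le_div_iff₀ (by positivity) (by positivity), one_mul]
  have h1 : (N.factorial * (N + 1) : ℝ) ≤ (N + (j + 1)).factorial := by
    have := Nat.factorial_le (show N + 1 ≤ N + (j + 1) by omega)
    rw [Nat.factorial_succ, mul_comm] at this
    exact_mod_cast this
  have h2 : (1 : ℝ) ≤ 4 ^ (j + 1) * (j + 1).factorial :=
    one_le_mul_of_one_le_of_one_le (one_le_pow₀ (by norm_num))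
      (by exact_mod_cast Nat.one_le_iff_ne_zero.mpr (Nat.factorial_ne_zero _))
  nlinarith [Nat.cast_nonneg (α := ℝ) (N + (j + 1)).factorial]

instance (d : ℕ) : Module.Finite ℝ (homogeneousSubmodule (Fin n) ℝ d) :=
  Module.Finite.iff_fg.mpr (homogeneousSubmodule_fg _ _ _)

/-- If `f` is a positive definite form, then for all large `N` it has a preimage under `reznickOp`
that is positive away from the origin. -/
lemma exists_pos_reznickOp_eq {d : ℕ} (f : homogeneousSubmodule (Fin n) ℝ d)
    (hf : ∀ x : Fin n → ℝ, x ≠ 0 → 0 < eval x (f : MvPolynomial (Fin n) ℝ)) :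
    ∀ᶠ N in atTop, ∃ h : homogeneousSubmodule (Fin n) ℝ d, reznickOp n d N h = f ∧
      ∀ x : Fin n → ℝ, x ≠ 0 → 0 < eval x (h : MvPolynomial (Fin n) ℝ) := by
  -- Coordinates move the operators to a normed space; T is conjugation by e.
  let b := Module.finBasis ℝ (homogeneousSubmodule (Fin n) ℝ d)
  let e := b.equivFun
  let T : Module.End ℝ (homogeneousSubmodule (Fin n) ℝ d) →ₗ[ℝ] (_ →L[ℝ] _) :=
    LinearMap.toContinuousLinearMap.toLinearMap ∘ₗ e.conj.toLinearMap
  have hT : ∀ B v, T B v = e (B (e.symm v)) := fun B v => rfl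
  have hA : Tendsto (fun N => T (reznickOp n d N)) atTop (𝓝 1) := by
    simp only [reznickOp, map_sum, map_smul]
    have h1 : (1 : (Fin (Module.finrank ℝ (homogeneousSubmodule (Fin n) ℝ d)) → ℝ) →L[ℝ] _) =
        ∑ j ∈ Finset.range (d + 1), (if j = 0 then (1 : ℝ) else 0) •
          T (sqNormLaplacian n d j) := by
      rw [Finset.sum_range_succ', Finset.sum_eq_zero fun j _ => by simp]
      ext v
      simp [hT, sqNormLaplacian_zero]
    rw [h1]
    refine tendsto_finsetSum _ fun j _ => Tendsto.smul_const ?_ _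
    rcases j with _ | j
    · refine tendsto_const_nhds.congr fun N => ?_
      have : (N.factorial : ℝ) ≠ 0 := by positivity
      simp [this]
    · simpa using tendsto_factorial_div j
  obtain ⟨h, hlim, heq⟩ := exists_tendsto_preimage hA (e f)
  have heval : ∀ (v : Fin (Module.finrank ℝ (homogeneousSubmodule (Fin n) ℝ d)) → ℝ) x,
      eval x (e.symm v : MvPolynomial (Fin n) ℝ) =
        ∑ i, v i * eval x (b i : MvPolynomial (Fin n) ℝ) := by
    intro v x
    simp [e, Module.Basis.equivFun_symm_apply, smul_eval]
  -- Positivity on the compact unit sphere is an open condition on the coefficients.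
  have hpos : ∀ᶠ v in 𝓝 (e f), ∀ x ∈ Metric.sphere (0 : Fin n → ℝ) 1,
      0 < eval x (e.symm v : MvPolynomial (Fin n) ℝ) := by
    refine (isCompact_sphere _ _).eventually_forall_of_forall_eventually fun x hx => ?_
    have hc : Continuous fun z : (Fin (Module.finrank ℝ (homogeneousSubmodule (Fin n) ℝ d)) → ℝ) ×
        (Fin n → ℝ) => eval z.2 (e.symm z.1 : MvPolynomial (Fin n) ℝ) := by
      simp_rw [heval]
      refine continuous_finsetSum _ fun i _ => ?_
      exact ((continuous_apply i).comp continuous_fst).mul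
        ((continuous_eval _).comp continuous_snd)
    refine hc.continuousAt.eventually (lt_mem_nhds ?_)
    simpa using hf x (Metric.ne_of_mem_sphere hx one_ne_zero)
  filter_upwards [heq, hlim.eventually hpos] with N h1 h2
  refine ⟨e.symm (h N), e.injective (by rw [← hT, h1]), fun x hx => ?_⟩
  have hx' : 0 < ‖x‖ := norm_pos_iff.mpr hx
  have := h2 (‖x‖⁻¹ • x) (by simp [norm_smul, hx'.ne'])
  rw [IsHomogeneous.eval_smul (e.symm (h N)).2] at this
  exact pos_of_mul_pos_right this (by positivity)

end MvPolynomial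

end Perturbation

/-! ### Sums of even powers from positivity. -/

section Main

open Filter Topology

variable {n : ℕ}

lemma psi_eq (f : MvPolynomial (Fin n) ℝ) (N : ℕ) : psi f N = sqNorm n ^ N * f := rfl

lemma eval_psi (f : MvPolynomial (Fin n) ℝ) (N : ℕ) (x : Fin n → ℝ) :
    eval x (psi f N) = (∑ i, x i ^ 2) ^ N * eval x f := by
  simp [psi_eq, eval_sqNorm]

lemma isHomogeneous_psi {d : ℕ} {f : MvPolynomial (Fin n) ℝ} (hf : f.IsHomogeneous d) (N : ℕ) :
    (psi f N).IsHomogeneous (2 * N + d) :=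
  (isHomogeneous_sqNorm.pow N).mul hf

lemma sum_sq_pos {x : Fin n → ℝ} (hx : x ≠ 0) : 0 < ∑ i, x i ^ 2 := by
  obtain ⟨i, hi⟩ := Function.ne_iff.mp hx
  exact Finset.sum_pos' (fun _ _ => sq_nonneg _) ⟨i, Finset.mem_univ _, sq_pos_of_ne_zero hi⟩

/-- Nonnegative weights are absorbed into the linear forms by taking 2m-th roots. -/
lemma isSumOfEvenPowers_sum {κ : Type*} [Fintype κ] (w : κ → ℝ) (hw : ∀ k, 0 ≤ w k)
    (a : κ → Fin n → ℝ) {m : ℕ} (hm : 1 ≤ m) :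
    IsSumOfEvenPowers (∑ k, C (w k) * linearForm (a k) ^ (2 * m)) := by
  let e := (Fintype.equivFin κ).symm
  refine ⟨Fintype.card κ, fun j => C (w (e j) ^ ((2 * m : ℕ) : ℝ)⁻¹) * linearForm (a (e j)),
    fun _ => m, fun j => (isHomogeneous_linearForm _).C_mul _, fun _ => hm, ?_⟩
  rw [← e.sum_comp]
  refine Finset.sum_congr rfl fun j _ => ?_
  rw [mul_pow, ← C_pow, Real.rpow_inv_natCast_pow (hw _) (by omega)]

lemma even_of_forall_eval_pos [NeZero n] {d : ℕ} {f : MvPolynomial (Fin n) ℝ}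
    (hf : f.IsHomogeneous d) (hpos : ∀ x : Fin n → ℝ, x ≠ 0 → 0 < eval x f) : Even d := by
  by_contra hd
  rw [Nat.not_even_iff_odd] at hd
  have h1 : (1 : Fin n → ℝ) ≠ 0 := one_ne_zero
  have h2 := hf.eval_smul (-1) 1
  rw [hd.neg_one_pow] at h2
  have h3 := hpos 1 h1
  have h4 := hpos ((-1 : ℝ) • 1) (by simp)
  linarith

/-- **Reznick's theorem** on uniform denominators. -/
theorem eventually_isSumOfEvenPowers {d : ℕ} {f : MvPolynomial (Fin n) ℝ} (hf : f.IsHomogeneous d)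
    (hpos : ∀ x : Fin n → ℝ, x ≠ 0 → 0 < eval x f) :
    ∀ᶠ N in atTop, IsSumOfEvenPowers (psi f N) := by
  -- With no variables |x|² = 0, so ψ_N is the empty sum once N ≥ 1.
  rcases Nat.eq_zero_or_pos n with rfl | hn
  · filter_upwards [eventually_ge_atTop 1] with N hN
    refine ⟨0, Fin.elim0, Fin.elim0, fun j => j.elim0, fun j => j.elim0, ?_⟩
    simp [psi, Nat.one_le_iff_ne_zero.mp hN]
  have : NeZero n := ⟨hn.ne'⟩
  obtain ⟨e, he⟩ := even_of_forall_eval_pos hf hpos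
  filter_upwards [exists_pos_reznickOp_eq ⟨f, hf⟩ hpos, eventually_ge_atTop 1]
    with N ⟨h, hh, hhpos⟩ hN
  obtain ⟨κ, _, w, a, hw, hid⟩ := exists_sqNorm_pow_eq_sum (n := n) (N + d)
  have key := diffOp_sqNorm_pow_eq_reznickOp N h
  rw [hh, hid, map_sum, ← psi_eq] at key
  set c : ℝ := (N + d).factorial * 2 ^ d / N.factorial with hc
  have hcpos : 0 < c := by positivity
  -- A node a_k may be 0, so nonnegativity is needed at the origin too.
  have hnn : ∀ x : Fin n → ℝ, 0 ≤ eval x (h : MvPolynomial (Fin n) ℝ) := by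
    intro x
    by_cases hx : x = 0
    · have h0 := IsHomogeneous.eval_smul h.2 0 1
      rw [zero_smul] at h0
      rw [hx, h0]
      exact mul_nonneg (by positivity) (hhpos 1 one_ne_zero).le
    · exact (hhpos x hx).le
  have hpsi : psi f N = C c⁻¹ * (C c * psi f N) := by
    rw [← mul_assoc, ← C_mul, inv_mul_cancel₀ hcpos.ne', C_1, one_mul]
  have heq : psi f N = ∑ k, C (c⁻¹ * w k * (((2 * (N + d)).descFactorial d : ℕ) *
      eval (a k) (h : MvPolynomial (Fin n) ℝ))) * linearForm (a k) ^ (2 * (N + e)) := by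
    rw [hpsi, ← key, Finset.mul_sum]
    refine Finset.sum_congr rfl fun k _ => ?_
    -- Evenness of d, with d = e + e, makes the remaining exponent 2N + d even.
    rw [C_mul' (a := w k), map_smul, diffOp_linearForm_pow _ _ h.2, ← C_mul',
      show 2 * (N + d) - d = 2 * (N + e) by omega,
      C_mul (a := c⁻¹ * w k), C_mul (a := c⁻¹)]
    ring
  rw [heq]
  refine isSumOfEvenPowers_sum _ (fun k => ?_) _ (by omega)
  have := hw k
  have := hnn (a k)
  positivity

/-! ### Convexity of such sums, and positivity from convexity. -/

lemma eval_linear {l : MvPolynomial (Fin n) ℝ} (hl : l.IsHomogeneous 1) :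
    ∃ L : (Fin n → ℝ) →ₗ[ℝ] ℝ, ∀ x, eval x l = L x := by
  have hl' : l ∈ homogeneousSubmodule (Fin n) ℝ 1 := hl
  rw [homogeneousSubmodule_one_eq_span_X] at hl'
  clear hl
  induction hl' using Submodule.span_induction with
  | mem p hp =>
    obtain ⟨i, rfl⟩ := hp
    exact ⟨LinearMap.proj i, fun x => by simp⟩
  | zero => exact ⟨0, by simp⟩
  | add p q _ _ h1 h2 =>
    obtain ⟨L, hL⟩ := h1
    obtain ⟨M, hM⟩ := h2
    exact ⟨L + M, fun x => by simp [hL, hM]⟩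
  | smul c p _ h =>
    obtain ⟨L, hL⟩ := h
    exact ⟨c • L, fun x => by simp [hL, smul_eval]⟩

lemma IsSumOfEvenPowers.convexOn {p : MvPolynomial (Fin n) ℝ} (hp : IsSumOfEvenPowers p) :
    ConvexOn ℝ Set.univ (fun x : Fin n → ℝ => eval x p) := by
  obtain ⟨r, l, k, hl, -, rfl⟩ := hp
  choose L hL using fun j => eval_linear (hl j)
  simp only [map_sum, map_pow, hL]
  refine ⟨convex_univ, fun x _ y _ a b ha hb hab => ?_⟩
  simp only [Finset.smul_sum, ← Finset.sum_add_distrib, map_add, map_smul]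
  exact Finset.sum_le_sum fun i _ =>
    (even_two_mul (k i)).convexOn_pow.2 trivial trivial ha hb hab

/-- If every linear form agreed at x and y, then p would vanish at x - y ≠ 0; so some summand gives
a strict inequality. -/
lemma IsSumOfEvenPowers.strictConvexOn {p : MvPolynomial (Fin n) ℝ} (hp : IsSumOfEvenPowers p)
    (hpos : ∀ x : Fin n → ℝ, x ≠ 0 → eval x p ≠ 0) :
    StrictConvexOn ℝ Set.univ (fun x : Fin n → ℝ => eval x p) := by
  obtain ⟨r, l, k, hl, hk, rfl⟩ := hp
  choose L hL using fun j => eval_linear (hl j)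
  simp only [map_sum, map_pow, hL] at hpos ⊢
  have hs : ∀ j, StrictConvexOn ℝ Set.univ fun t : ℝ => t ^ (2 * k j) := fun j =>
    (even_two_mul (k j)).strictConvexOn_pow (by have := hk j; omega)
  refine ⟨convex_univ, fun x _ y _ hxy a b ha hb hab => ?_⟩
  simp only [Finset.smul_sum, ← Finset.sum_add_distrib, map_add, map_smul]
  obtain ⟨j, hj⟩ : ∃ j, L j x ≠ L j y := by
    by_contra! h
    refine hpos (x - y) (sub_ne_zero.mpr hxy) (Finset.sum_eq_zero fun j _ => ?_)
    rw [map_sub, h j, sub_self, zero_pow (by have := hk j; omega)]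
  refine Finset.sum_lt_sum (fun i _ => ?_) ⟨j, Finset.mem_univ _, ?_⟩
  · exact (hs i).convexOn.2 trivial trivial ha.le hb.le hab
  · exact (hs j).2 trivial trivial hj ha hb hab

/-- A convex form of degree at least two is nonnegative. -/
lemma eval_nonneg_of_convexOn {D : ℕ} {g : MvPolynomial (Fin n) ℝ} (hg : g.IsHomogeneous D)
    (hD : 2 ≤ D) (hc : ConvexOn ℝ Set.univ (fun x : Fin n → ℝ => eval x g)) (x : Fin n → ℝ) :
    0 ≤ eval x g := by
  -- As x is the midpoint of 2x and 0, convexity gives g(x) ≤ 2^D g(x) / 2.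
  have h := hc.2 (Set.mem_univ ((2 : ℝ) • x)) (Set.mem_univ ((0 : ℝ) • x))
    (by norm_num : (0 : ℝ) ≤ 1 / 2) (by norm_num : (0 : ℝ) ≤ 1 / 2) (by norm_num)
  simp only [smul_eq_mul, hg.eval_smul] at h
  rw [zero_smul, smul_zero, add_zero, smul_smul, zero_pow (by omega)] at h
  norm_num at h
  have h4 : (4 : ℝ) ≤ 2 ^ D := by
    calc (4 : ℝ) = 2 ^ 2 := by norm_num
      _ ≤ 2 ^ D := pow_le_pow_right₀ (by norm_num) hD
  nlinarith

/-- A convex form does not increase in the direction of a line on which it vanishes. -/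
lemma eval_add_smul_le_of_convexOn {D : ℕ} {g : MvPolynomial (Fin n) ℝ} (hg : g.IsHomogeneous D)
    (hc : ConvexOn ℝ Set.univ (fun x : Fin n → ℝ => eval x g)) {v : Fin n → ℝ}
    (hv : eval v g = 0) (w : Fin n → ℝ) (t : ℝ) : eval (w + t • v) g ≤ eval w g := by
  -- The point (1-s)(w + tv) is a convex combination of w and a multiple of v, where g vanishes.
  -- Then s → 0.
  have key : ∀ s ∈ Set.Ioo (0 : ℝ) 1, (1 - s) ^ D * eval (w + t • v) g ≤ (1 - s) * eval w g := by
    intro s hs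
    have h := hc.2 (Set.mem_univ w) (Set.mem_univ (((1 - s) * t / s) • v))
      (sub_nonneg.mpr hs.2.le) hs.1.le (by ring)
    simp only [smul_eq_mul, hg.eval_smul, hv, mul_zero, add_zero] at h
    rwa [← hg.eval_smul, smul_add, smul_smul,
      show (1 - s) * t = s * ((1 - s) * t / s) by field_simp [hs.1.ne'], ← smul_smul s]
  have hne : (𝓝[>] (0 : ℝ)).NeBot := inferInstance
  have l1 : Tendsto (fun s : ℝ => (1 - s) ^ D * eval (w + t • v) g) (𝓝[>] 0)
      (𝓝 (eval (w + t • v) g)) := by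
    have : Continuous fun s : ℝ => (1 - s) ^ D * eval (w + t • v) g := by fun_prop
    simpa using (this.tendsto 0).mono_left nhdsWithin_le_nhds
  have l2 : Tendsto (fun s : ℝ => (1 - s) * eval w g) (𝓝[>] 0) (𝓝 (eval w g)) := by
    have : Continuous fun s : ℝ => (1 - s) * eval w g := by fun_prop
    simpa using (this.tendsto 0).mono_left nhdsWithin_le_nhds
  exact le_of_tendsto_of_tendsto l1 l2 (eventually_of_mem (Ioo_mem_nhdsGT one_pos) key)

lemma eval_add_smul_eq_of_convexOn {D : ℕ} {g : MvPolynomial (Fin n) ℝ} (hg : g.IsHomogeneous D)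
    (hc : ConvexOn ℝ Set.univ (fun x : Fin n → ℝ => eval x g)) {v : Fin n → ℝ}
    (hv : eval v g = 0) (w : Fin n → ℝ) (t : ℝ) : eval (w + t • v) g = eval w g := by
  refine (eval_add_smul_le_of_convexOn hg hc hv w t).antisymm ?_
  simpa [add_assoc, ← add_smul] using
    eval_add_smul_le_of_convexOn hg hc hv (w + t • v) (-t)

lemma eval_pos_of_eventually_convexOn {d : ℕ} {f : MvPolynomial (Fin n) ℝ}
    (hf : f.IsHomogeneous d) (hf0 : f ≠ 0)
    (hc : ∀ᶠ N in atTop, ConvexOn ℝ Set.univ (fun x : Fin n → ℝ => eval x (psi f N)))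
    {v : Fin n → ℝ} (hv : v ≠ 0) : 0 < eval v f := by
  obtain ⟨N, hN⟩ := eventually_atTop.mp (hc.and (eventually_ge_atTop 1))
  have hconv := fun M (hM : N ≤ M) => (hN M hM).1
  have hN1 := (hN N le_rfl).2
  have hvpos := sum_sq_pos hv
  have hnn : 0 ≤ eval v f := by
    have := eval_nonneg_of_convexOn (isHomogeneous_psi hf N) (by omega) (hconv N le_rfl) v
    rw [eval_psi] at this
    exact nonneg_of_mul_nonneg_right this (by positivity)
  refine hnn.lt_of_ne' fun h0 => hf0 ?_
  have hshift : ∀ M, N ≤ M → ∀ w t, eval (w + t • v) (psi f M) = eval w (psi f M) := fun M hM w t =>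
    eval_add_smul_eq_of_convexOn (isHomogeneous_psi hf M) (hconv M hM)
      (by rw [eval_psi, h0, mul_zero]) w t
  have hzero : psi f N = 0 := by
    refine MvPolynomial.funext fun w => ?_
    rw [map_zero]
    by_contra hw
    -- Cancel ψ_N(w) ≠ 0 between the invariance of ψ_N and that of ψ_(N+1) = |x|² ψ_N.
    have hnorm : ∀ t : ℝ, ∑ i, (w i + t * v i) ^ 2 = ∑ i, w i ^ 2 := by
      intro t
      have e1 := hshift N le_rfl w t
      have e2 := hshift (N + 1) (Nat.le_succ N) w t
      rw [eval_psi, eval_psi, pow_succ', pow_succ', mul_assoc, mul_assoc, ← eval_psi, ← eval_psi,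
        e1] at e2
      simpa using mul_right_cancel₀ hw e2
    have h1 := hnorm 1
    have h2 := hnorm (-1)
    -- The parallelogram law forces |v|² = 0.
    have h3 : ∑ i, (w i + 1 * v i) ^ 2 + ∑ i, (w i + -1 * v i) ^ 2 =
        2 * ∑ i, w i ^ 2 + 2 * ∑ i, v i ^ 2 := by
      rw [← Finset.sum_add_distrib, Finset.mul_sum, Finset.mul_sum, ← Finset.sum_add_distrib]
      exact Finset.sum_congr rfl fun i _ => by ring
    linarith
  have hr : sqNorm n ^ N ≠ 0 := by
    refine pow_ne_zero _ fun h => hvpos.ne' ?_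
    rw [← eval_sqNorm, h, map_zero]
  exact (mul_eq_zero.mp hzero).resolve_left hr

end Main

end

theorem mainTheorem9 (n d : ℕ) (f : MvPolynomial (Fin n) ℝ) (hf : f.IsHomogeneous d)
    (hf0 : f ≠ 0) :
    List.TFAE [
      ∀ x : Fin n → ℝ, x ≠ 0 → 0 < MvPolynomial.eval x f,
      ∃ N₁ : ℕ, ∀ N : ℕ, N₁ ≤ N → IsSumOfEvenPowers (psi f N),
      ∃ N₂ : ℕ, ∀ N : ℕ, N₂ ≤ N →
        ConvexOn ℝ Set.univ (fun x : Fin n → ℝ => MvPolynomial.eval x (psi f N)),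
      ∃ N₃ : ℕ, ∀ N : ℕ, N₃ ≤ N →
        StrictConvexOn ℝ Set.univ (fun x : Fin n → ℝ => MvPolynomial.eval x (psi f N))] := by
  simp only [← Filter.eventually_atTop]
  tfae_have 1 → 2 := fun h => eventually_isSumOfEvenPowers hf h
  tfae_have 2 → 3 := fun h => h.mono fun N hN => hN.convexOn
  tfae_have 3 → 1 := fun h x hx => eval_pos_of_eventually_convexOn hf hf0 h hx
  tfae_have 1 → 4 := fun h => (eventually_isSumOfEvenPowers hf h).mono fun N hN =>
    hN.strictConvexOn fun x hx => by
      rw [eval_psi]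
      exact (mul_pos (pow_pos (sum_sq_pos hx) N) (h x hx)).ne'
  tfae_have 4 → 3 := fun h => h.mono fun N hN => hN.convexOn
  tfae_finish
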